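/- Let $K$ be a compact Hausdorff space, let $E$ be a Banach space over $\mathbb F\in\{\mathbb R,\mathbb C\}$, let $C(K,E)$ be the space of continuous functions $K\to E$ with the supremum norm, and let $H\subset C(K,E)$ be a function space, i.e. a linear subspace. Let $B_{X}$ denote the closed unit ball of a normed space $X$ and $\operatorname{ext}$ the set of extreme points; $B_{E^*}$ carries the weak$^*$ topology in the products below. Put $$H_w=\operatorname{span}\{x^*\circ \boldsymbol f;\ \boldsymbol f\in H,\ x^*\in E^*\}\subset C(K,\mathbb F),$$ $$H_s=\{(s,x^*)\mapsto x^*(\boldsymbol f(s))+g(s);\ \boldsymbol f\in H,\ g\in H_w\}\subset C(K\times B_{E^*},\mathbb F).$$ Let $\phi_H\colon K\to L(H,E)$ be the evaluation mapping into the bounded linear operators, $\phi_H(s)(\boldsymbol h)=\boldsymbol h(s)$, and let $\phi_{H_w}\colon K\to H_w^*$ and $\phi_{H_s}\colon K\times B_{E^*}\to H_s^*$ be the analogous evaluation mappings of the scalar function spaces $H_w$ and $H_s$. Let $t\in K$. Then the following assertions are equivalent: 1. $\phi_H(t)$ is an extreme point of $\overline{\operatorname{aco}}^{WOT}\phi_H(K)$,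 the closure in the weak operator topology of the absolutely convex hull of $\phi_H(K)$ in $L(H,E)$; 2. $\phi_{H_w}(t)\in\operatorname{ext} B_{H_w^*}$; 3. $\phi_{H_s}(t,x^*)\in\operatorname{ext} B_{H_s^*}$ for some $x^*\in B_{E^*}$; 4. $\phi_{H_s}(t,e^*)\in\operatorname{ext} B_{H_s^*}$ for some $e^*\in\operatorname{ext} B_{E^*}$. If, moreover, $H(t)=\{\boldsymbol f(t);\ \boldsymbol f\in H\}$ is dense in $E$, these assertions are also equivalent to 5. $\phi_{H_s}(t,e^*)\in\operatorname{ext} B_{H_s^*}$ for each $e^*\in\operatorname{ext} B_{E^*}$. -/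

import Mathlib

open scoped ComplexOrder

namespace VectorFunctionSpace

section

variable (𝕜 : Type*) [RCLike 𝕜]

/-- The set `ext B_{X^*}` of extreme points of the closed unit ball of the dual of a normed
space `X`. Convexity notions over `𝕜 = ℝ` or `ℂ` are taken with respect to the order on `𝕜` for
which `0 < a` means that `a` is real and positive; so these are the usual extreme points, as
`openSegment_eq_real` below confirms. -/
def extDualBall (X : Type*) [SeminormedAddCommGroup X] [NormedSpace 𝕜 X] :
    Set (StrongDual 𝕜 X) :=
  (Metric.closedBall (0 : StrongDual 𝕜 X) 1).extremePoints 𝕜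

/-- Open segments over `𝕜`, and hence extreme points over `𝕜`, are the usual real ones. -/
theorem openSegment_eq_real {V : Type*} [AddCommGroup V] [Module 𝕜 V] [Module ℝ V]
    [IsScalarTower ℝ 𝕜 V] (x y : V) : openSegment 𝕜 x y = openSegment ℝ x y := by
  ext z
  constructor
  · rintro ⟨a, b, ha, hb, hab, rfl⟩
    obtain ⟨ha1, ha2⟩ := RCLike.pos_iff.1 ha
    obtain ⟨hb1, hb2⟩ := RCLike.pos_iff.1 hb
    have ea : ((RCLike.re a : ℝ) : 𝕜) = a := RCLike.ext (by simp) (by simp [ha2])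
    have eb : ((RCLike.re b : ℝ) : 𝕜) = b := RCLike.ext (by simp) (by simp [hb2])
    refine ⟨RCLike.re a, RCLike.re b, ha1, hb1, ?_, ?_⟩
    · simpa using congrArg RCLike.re hab
    · rw [← algebraMap_smul 𝕜 (RCLike.re a) x, ← algebraMap_smul 𝕜 (RCLike.re b) y,
        RCLike.algebraMap_eq_ofReal, ea, eb]
  · rintro ⟨a, b, ha, hb, hab, rfl⟩
    refine ⟨(a : 𝕜), (b : 𝕜), by exact_mod_cast ha, by exact_mod_cast hb,
      by exact_mod_cast hab, ?_⟩
    rw [← RCLike.algebraMap_eq_ofReal, algebraMap_smul,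
      algebraMap_smul]

/-- The closed unit ball `B_{E^*}` of the dual space, with the weak* topology. -/
abbrev DualBall (E : Type*) [NormedAddCommGroup E] [NormedSpace 𝕜 E] : Type _ :=
  ↥(WeakDual.toStrongDual ⁻¹' Metric.closedBall (0 : StrongDual 𝕜 E) 1)

instance instCompactSpaceDualBall (E : Type*) [NormedAddCommGroup E] [NormedSpace 𝕜 E] :
    CompactSpace (DualBall 𝕜 E) :=
  isCompact_iff_compactSpace.mp (WeakDual.isCompact_closedBall 0 1)

end

section

variable {𝕜 K E : Type*} [RCLike 𝕜] [TopologicalSpace K]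
  [NormedAddCommGroup E] [NormedSpace 𝕜 E]

theorem continuous_pairing (f : C(K, E)) :
    Continuous fun p : K × DualBall 𝕜 E => (p.2 : WeakDual 𝕜 E) (f p.1) := by
  rw [continuous_iff_continuousAt]
  rintro ⟨t, x⟩
  have h1 : Filter.Tendsto (fun p : K × DualBall 𝕜 E => (p.2 : WeakDual 𝕜 E) (f t))
      (nhds (t, x)) (nhds ((x : WeakDual 𝕜 E) (f t))) :=
    ((WeakDual.eval_continuous (f t)).comp
      (continuous_subtype_val.comp continuous_snd)).tendsto (t, x)
  have h2 : Filter.Tendsto (fun p : K × DualBall 𝕜 E => ‖f p.1 - f t‖)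
      (nhds (t, x)) (nhds 0) := by
    have h : Continuous fun p : K × DualBall 𝕜 E => ‖f p.1 - f t‖ := by fun_prop
    simpa using h.tendsto (t, x)
  have h3 : Filter.Tendsto (fun p : K × DualBall 𝕜 E => (p.2 : WeakDual 𝕜 E) (f p.1 - f t))
      (nhds (t, x)) (nhds 0) := by
    refine squeeze_zero_norm (fun p => ?_) h2
    have hp : ‖WeakDual.toStrongDual (p.2 : WeakDual 𝕜 E)‖ ≤ 1 := by
      exact mem_closedBall_zero_iff.mp p.2.2
    simpa using (WeakDual.toStrongDual (p.2 : WeakDual 𝕜 E)).le_of_opNorm_le hp (f p.1 - f t)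
  have h4 := h3.add h1
  simp only [map_sub, sub_add_cancel, zero_add] at h4
  exact h4

/-- The operator `T : C(K,E) → C(K × B_{E^*}, 𝕜)`, `T f (t, x^*) = x^* (f t)`. -/
noncomputable def opT : C(K, E) →ₗ[𝕜] C(K × DualBall 𝕜 E, 𝕜) where
  toFun f := ⟨fun p => (p.2 : WeakDual 𝕜 E) (f p.1), continuous_pairing f⟩
  map_add' f g := by ext p; simp
  map_smul' c f := by ext p; simp

/-- The operator `f ↦ f ∘ π₁` from `C(K, 𝕜)` to `C(K × B_{E^*}, 𝕜)`. -/
noncomputable def compFst : C(K, 𝕜) →ₗ[𝕜] C(K × DualBall 𝕜 E, 𝕜) where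
  toFun f := f.comp ContinuousMap.fst
  map_add' _ _ := rfl
  map_smul' _ _ := rfl

/-- `H_w = span {x^* ∘ f ; f ∈ H, x^* ∈ E^*}`. -/
noncomputable def weakSpace (H : Submodule 𝕜 C(K, E)) : Submodule 𝕜 C(K, 𝕜) :=
  Submodule.span 𝕜 {g | ∃ f ∈ H, ∃ x : StrongDual 𝕜 E, g = (x : C(E, 𝕜)).comp f}

/-- `H_s = T(H) + {f ∘ π₁ ; f ∈ H_w}`. -/
noncomputable def strongSpace (H : Submodule 𝕜 C(K, E)) : Submodule 𝕜 C(K × DualBall 𝕜 E, 𝕜) :=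
  H.map opT ⊔ (weakSpace H).map compFst

/-- The evaluation mapping `φ_H : K → L(H, E)`, `φ_H(t)(h) = h(t)`. For a scalar function space,
`E = 𝕜`, it takes values in the dual space of `H`. -/
noncomputable def evalMap [CompactSpace K] (H : Submodule 𝕜 C(K, E)) (t : K) : H →L[𝕜] E :=
  (ContinuousMap.evalCLM 𝕜 t).comp H.subtypeL

/-- The closure in the weak operator topology of the absolutely convex hull of `φ_H(K)`. -/
noncomputable def wotClosedHull [CompactSpace K] (H : Submodule 𝕜 C(K, E)) : Set (H →WOT[𝕜] E) :=
  closure (absConvexHull 𝕜 (Set.range fun s : K => ContinuousLinearMapWOT.ofCLM (evalMap H s)))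

end

end VectorFunctionSpace

open VectorFunctionSpace

/-! For 1 ⇔ 2, a functional `p` on $H_w$ is turned into an operator $H\to E$. For fixed $f$, the map
$x^*\mapsto p(x^*\circ f)$ is represented by a vector of $E$: after scaling `p` into the ball,
Hahn-Banach places it in the closed convex hull of the rotations of $f(K)$, which is norm compact
because $E$ is complete. The resulting linear injection `reprOpₗ` is continuous from weak* to WOT,
sends $\phi_{H_w}(s)$ to $\phi_H(s)$ and the dual ball onto the WOT-closed hull
(`image_reprOpₗ_closedBall`), so it matches extreme points.

For the rest, $H_w$ embeds contractively in $H_s$ as functions independent of $x^*$, and restriction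
to a slice $K\times\{x^*\}$ is a contractive left inverse; this gives 3 ⇒ 2. If $\phi_{H_w}(t)$ is
extreme, the norm-one extensions of it to $H_s$ form a weak* compact face of $B_{H_s^*}$. By
Milman's theorem its extreme points are rotated evaluations, and the slice restriction shows that
they are evaluations at points $(t,y)$. Such a point exists, and the functionals agreeing with $y$
on $H(t)$ form a face of $B_{E^*}$, any extreme point $e^*$ of which gives 4. By Krein-Milman the
whole face of extensions consists of evaluations $\phi_{H_s}(t,x^*)$; when $H(t)$ is dense these
determine $x^*$, so extremality of $e^*$ passes to $\phi_{H_s}(t,e^*)$. -/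

namespace VectorFunctionSpace

/-! ### Milman and Krein-Milman theorems -/

section Milman

/-- An extreme point lying in the convex join of two subsets lies in one of them. -/
theorem mem_or_mem_of_mem_extremePoints_of_mem_convexJoin {V : Type*} [AddCommGroup V]
    [Module ℝ V] {C s t : Set V} {p : V}
    (hp : p ∈ C.extremePoints ℝ) (hs : s ⊆ C) (ht : t ⊆ C) (h : p ∈ convexJoin ℝ s t) :
    p ∈ s ∨ p ∈ t := by
  obtain ⟨a, ha, b, hb, hab⟩ := mem_convexJoin.1 h
  rcases (mem_extremePoints_iff_forall_segment.1 hp).2 a (hs ha) b (ht hb) hab with rfl | rfl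
  · exact .inl ha
  · exact .inr hb

variable {V : Type*} [AddCommGroup V] [Module ℝ V] [TopologicalSpace V]

theorem Convex.isCompact_convexJoin [IsTopologicalAddGroup V] [ContinuousSMul ℝ V] {s t : Set V}
    (hs : IsCompact s) (ht : IsCompact t) : IsCompact (convexJoin ℝ s t) := by
  have h : convexJoin ℝ s t =
      (fun q : ℝ × V × V => (1 - q.1) • q.2.1 + q.1 • q.2.2) '' (Set.Icc 0 1 ×ˢ s ×ˢ t) := by
    ext x
    simp only [mem_convexJoin, segment_eq_image, Set.mem_image, Set.mem_prod, Prod.exists]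
    constructor
    · rintro ⟨a, ha, b, hb, θ, hθ, rfl⟩
      exact ⟨θ, a, b, ⟨hθ, ha, hb⟩, rfl⟩
    · rintro ⟨θ, a, b, ⟨hθ, ha, hb⟩, rfl⟩
      exact ⟨a, ha, b, hb, θ, hθ, rfl⟩
  rw [h]
  exact (isCompact_Icc.prod (hs.prod ht)).image (by fun_prop)

/-- **Milman's theorem**, the partial converse of the Krein-Milman theorem: if every closed convex
set containing `A` contains `C`, then the extreme points of `C` lie in `A`. -/
theorem mem_of_mem_extremePoints_of_forall_closed_convex_subset [T2Space V] [IsTopologicalAddGroup V]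
    [ContinuousSMul ℝ V] [LocallyConvexSpace ℝ V] {A C : Set V} (hA : IsCompact A)
    (hC : IsCompact C) (hconv : Convex ℝ C) (hAC : A ⊆ C)
    (h : ∀ D : Set V, Convex ℝ D → IsClosed D → A ⊆ D → C ⊆ D) {p : V} (hp : p ∈ C.extremePoints ℝ) : p ∈ A := by
  by_contra hpA
  have hcc : ∀ s : Set V, closure (convexHull ℝ (s ∩ A)) ⊆ C := fun s =>
    closure_minimal (convexHull_min (Set.inter_subset_right.trans hAC) hconv) hC.isClosed
  have hcpt : ∀ s : Set V, IsCompact (closure (convexHull ℝ (s ∩ A))) := fun s =>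
    hC.of_isClosed_subset isClosed_closure (hcc s)
  -- Compactness induction over pieces `s ∩ A`: if `p` avoids the closed hulls of small pieces, it
  -- avoids that of `A`.
  have key : p ∉ closure (convexHull ℝ (A ∩ A)) := by
    refine hA.induction_on (p := fun s => p ∉ closure (convexHull ℝ (s ∩ A))) (by simp) ?_ ?_ ?_
    · intro s t hst ht hs
      exact ht (closure_mono (convexHull_mono (Set.inter_subset_inter_left _ hst)) hs)
    · intro s t hs ht hst
      rw [Set.union_inter_distrib_right] at hst
      rcases (s ∩ A).eq_empty_or_nonempty with h1 | h1
      · rw [h1, Set.empty_union] at hst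
        exact ht hst
      rcases (t ∩ A).eq_empty_or_nonempty with h2 | h2
      · rw [h2, Set.union_empty] at hst
        exact hs hst
      -- The join of two compact sets is compact, so no further closure is needed, and extremality
      -- of `p` puts it in one of the two hulls.
      have hsub : closure (convexHull ℝ (s ∩ A ∪ t ∩ A)) ⊆
          convexJoin ℝ (closure (convexHull ℝ (s ∩ A))) (closure (convexHull ℝ (t ∩ A))) := by
        refine closure_minimal ?_ (Convex.isCompact_convexJoin (hcpt s) (hcpt t)).isClosed
        rw [convexHull_union h1 h2]
        exact convexJoin_mono subset_closure subset_closure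
      exact (mem_or_mem_of_mem_extremePoints_of_mem_convexJoin hp (hcc s) (hcc t)
        (hsub hst)).elim hs ht
    · intro a ha
      -- The half-space cut at the midpoint of `f a` and `f p` is a neighbourhood of `a` whose
      -- closed version misses `p`.
      obtain ⟨f, hf⟩ := geometric_hahn_banach_point_point (ne_of_mem_of_not_mem ha hpA)
      refine ⟨{x | f x < (f a + f p) / 2}, mem_nhdsWithin_of_mem_nhds
        ((isOpen_lt f.continuous continuous_const).mem_nhds
          (show f a < (f a + f p) / 2 by linarith)), fun hmem => ?_⟩
      have hsub : closure (convexHull ℝ ({x | f x < (f a + f p) / 2} ∩ A)) ⊆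
          {x | f x ≤ (f a + f p) / 2} :=
        closure_minimal (convexHull_min (fun x hx => show f x ≤ _ from le_of_lt hx.1)
          (convex_halfSpace_le f.toLinearMap.isLinear _))
          (isClosed_le f.continuous continuous_const)
      have : f p ≤ (f a + f p) / 2 := hsub hmem
      linarith
  rw [Set.inter_self] at key
  exact key (h _ (convex_convexHull ℝ A).closure isClosed_closure
    ((subset_convexHull ℝ A).trans subset_closure) hp.1)

/-- The **Krein-Milman theorem**, stated without closed convex hulls. -/
theorem subset_of_extremePoints_subset [T2Space V] [IsTopologicalAddGroup V]
    [ContinuousSMul ℝ V] [LocallyConvexSpace ℝ V] {C D : Set V} (hC : IsCompact C)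
    (hCconv : Convex ℝ C) (hD : IsClosed D) (hDconv : Convex ℝ D)
    (h : C.extremePoints ℝ ⊆ D) : C ⊆ D := by
  rw [← closure_convexHull_extremePoints hC hCconv]
  exact closure_minimal (convexHull_min h hDconv) hD

end Milman

/-! ### The dual unit ball in the weak* topology -/

section WeakStar

variable {𝕜 X : Type*} [RCLike 𝕜] [NormedAddCommGroup X] [NormedSpace 𝕜 X]

instance instIsScalarTowerWeakDual : IsScalarTower ℝ 𝕜 (WeakDual 𝕜 X) :=
  inferInstanceAs (IsScalarTower ℝ 𝕜 (StrongDual 𝕜 X))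

instance instLocallyConvexSpaceWeakDual : LocallyConvexSpace ℝ (WeakDual 𝕜 X) :=
  (WeakDual.withSeminorms 𝕜 X).toLocallyConvexSpace

variable (𝕜 X) in
/-- The closed unit ball of the dual, as a subset of the weak* dual. -/
def weakBall : Set (WeakDual 𝕜 X) := WeakDual.toStrongDual ⁻¹' Metric.closedBall 0 1

theorem mem_weakBall_iff {p : WeakDual 𝕜 X} : p ∈ weakBall 𝕜 X ↔ ∀ x, ‖p x‖ ≤ ‖x‖ := by
  rw [weakBall, Set.mem_preimage, mem_closedBall_zero_iff]
  constructor
  · intro h x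
    simpa using (WeakDual.toStrongDual p).le_of_opNorm_le h x
  · intro h
    exact ContinuousLinearMap.opNorm_le_bound _ zero_le_one fun x => by simpa using h x

theorem isCompact_weakBall : IsCompact (weakBall 𝕜 X) := WeakDual.isCompact_closedBall 0 1

theorem convex_weakBall : Convex ℝ (weakBall 𝕜 X) := by
  intro p hp q hq a b ha hb hab
  rw [mem_weakBall_iff] at hp hq ⊢
  intro x
  change ‖a • p x + b • q x‖ ≤ _
  calc ‖a • p x + b • q x‖ ≤ a * ‖p x‖ + b * ‖q x‖ := by
        refine (norm_add_le _ _).trans_eq ?_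
        rw [norm_smul, norm_smul, Real.norm_of_nonneg ha, Real.norm_of_nonneg hb]
    _ ≤ a * ‖x‖ + b * ‖x‖ := by gcongr <;> [exact hp x; exact hq x]
    _ = ‖x‖ := by rw [← add_mul, hab, one_mul]

theorem weakDual_combo_self (p : WeakDual 𝕜 X) {a b : ℝ} (hab : a + b = 1) :
    a • p + b • p = p := by
  refine DFunLike.ext _ _ fun x => ?_
  change a • p x + b • p x = p x
  rw [← add_smul, hab, one_smul]

/-- Extremality depends only on the real linear structure, so it may be studied in the weak*
topology, where the ball is compact. -/
theorem mem_extDualBall_iff {f : StrongDual 𝕜 X} :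
    f ∈ extDualBall 𝕜 X ↔ StrongDual.toWeakDual f ∈ (weakBall 𝕜 X).extremePoints ℝ := by
  simp only [extDualBall, mem_extremePoints_iff_left]
  refine and_congr Iff.rfl ?_
  have key : ∀ f g h : StrongDual 𝕜 X, f ∈ openSegment 𝕜 g h ↔
      StrongDual.toWeakDual f ∈ openSegment ℝ (StrongDual.toWeakDual g)
        (StrongDual.toWeakDual h) := by
    intro f g h
    rw [openSegment_eq_real]
    rfl
  constructor
  · intro hf g hg h hh hs
    exact hf g hg h hh ((key _ _ _).2 hs)
  · intro hf g hg h hh hs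
    exact hf g hg h hh ((key _ _ _).1 hs)

/-- Weak* continuous functionals are evaluations. -/
theorem exists_forall_eq_apply (f : StrongDual 𝕜 (WeakDual 𝕜 X)) :
    ∃ x : X, ∀ q : WeakDual 𝕜 X, f q = q x := by
  obtain ⟨x, hx⟩ := LinearMap.dualEmbedding_surjective (topDualPairing 𝕜 X) f
  exact ⟨x, fun q => by rw [← hx]; rfl⟩

/-- Hahn-Banach separation in the weak* topology. -/
theorem mem_of_forall_exists_re_le {C : Set (WeakDual 𝕜 X)} (hconv : Convex ℝ C)
    (hclosed : IsClosed C) {p : WeakDual 𝕜 X}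
    (h : ∀ x : X, ∃ c ∈ C, RCLike.re (p x) ≤ RCLike.re (c x)) : p ∈ C := by
  by_contra hp
  have hsep := RCLike.geometric_hahn_banach_closed_point (𝕜 := 𝕜) (E := WeakDual 𝕜 X) (s := C)
    (x := p) hconv hclosed hp
  obtain ⟨f, u, hf, hu⟩ := hsep
  obtain ⟨x, hfx⟩ := exists_forall_eq_apply f
  obtain ⟨c, hc, hle⟩ := h x
  have := hf c hc
  rw [hfx] at this hu
  linarith

theorem convex_weakDual_iff {C : Set (WeakDual 𝕜 X)} : Convex 𝕜 C ↔ Convex ℝ C := by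
  have h := convex_RCLike_iff_convex_real (K := 𝕜) (E := WeakDual 𝕜 X) (s := C)
  exact h

theorem absConvex_closedBall_strongDual :
    AbsConvex 𝕜 (Metric.closedBall (0 : StrongDual 𝕜 X) 1) :=
  ⟨balanced_closedBall_zero, convex_RCLike_iff_convex_real.2 (convex_closedBall _ _)⟩

/-- A closed convex set norming `X` contains the dual unit ball. -/
theorem weakBall_subset_of_forall_exists_norm_le {C : Set (WeakDual 𝕜 X)} (hconv : Convex ℝ C)
    (hclosed : IsClosed C) (h : ∀ x : X, ∃ c ∈ C, ‖x‖ ≤ RCLike.re (c x)) : weakBall 𝕜 X ⊆ C := by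
  intro p hp
  refine mem_of_forall_exists_re_le hconv hclosed fun x => ?_
  obtain ⟨c, hc, hx⟩ := h x
  exact ⟨c, hc, (RCLike.re_le_norm _).trans ((mem_weakBall_iff.1 hp x).trans hx)⟩

/-- A compact norming subset of the dual unit ball contains all extreme points of the ball. -/
theorem extremePoints_weakBall_subset {A : Set (WeakDual 𝕜 X)} (hA : IsCompact A)
    (hsub : A ⊆ weakBall 𝕜 X) (h : ∀ x : X, ∃ c ∈ A, ‖x‖ ≤ RCLike.re (c x)) :
    (weakBall 𝕜 X).extremePoints ℝ ⊆ A := by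
  intro p hp
  have hmin : ∀ D : Set (WeakDual 𝕜 X), Convex ℝ D → IsClosed D → A ⊆ D → weakBall 𝕜 X ⊆ D := by
    intro D hD hD' hAD
    refine weakBall_subset_of_forall_exists_norm_le hD hD' fun x => ?_
    obtain ⟨c, hc, hx⟩ := h x
    exact ⟨c, hAD hc, hx⟩
  have hmilman := mem_of_mem_extremePoints_of_forall_closed_convex_subset (V := WeakDual 𝕜 X)
    (A := A) (C := weakBall 𝕜 X) (p := p)
  exact hmilman hA isCompact_weakBall convex_weakBall hsub hmin hp

theorem exists_mem_extremePoints_of_isCompact {A : Set (WeakDual 𝕜 X)} (hA : IsCompact A)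
    (hne : A.Nonempty) : ∃ p, p ∈ A.extremePoints ℝ :=
  hA.extremePoints_nonempty hne

theorem subset_of_extremePoints_subset_weakDual {C D : Set (WeakDual 𝕜 X)} (hC : IsCompact C)
    (hCconv : Convex ℝ C) (hD : IsClosed D) (hDconv : Convex ℝ D)
    (h : C.extremePoints ℝ ⊆ D) : C ⊆ D := by
  have hkm := subset_of_extremePoints_subset (V := WeakDual 𝕜 X) (C := C) (D := D)
  exact hkm hC hCconv hD hDconv h

/-- A function in `C(K, E)` attains its norm. -/
theorem exists_norm_apply_eq_norm {K E : Type*} [TopologicalSpace K] [CompactSpace K] [Nonempty K]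
    [NormedAddCommGroup E] (f : C(K, E)) : ∃ s, ‖f s‖ = ‖f‖ := by
  obtain ⟨s, -, hs⟩ := isCompact_univ.exists_isMaxOn Set.univ_nonempty
    (f := fun s => ‖f s‖) (by fun_prop)
  exact ⟨s, le_antisymm (f.norm_coe_le_norm s)
    ((ContinuousMap.norm_le _ (norm_nonneg _)).2 fun x => hs (Set.mem_univ x))⟩

/-- A scalar continuous function attains its norm, up to rotation. -/
theorem exists_norm_one_mul_apply_eq_norm {K : Type*} [TopologicalSpace K] [CompactSpace K]
    [Nonempty K] (f : C(K, 𝕜)) : ∃ c : 𝕜, ‖c‖ = 1 ∧ ∃ s, c * f s = (‖f‖ : 𝕜) := by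
  obtain ⟨s, hs⟩ := exists_norm_apply_eq_norm f
  obtain ⟨c, hc, h⟩ := RCLike.exists_norm_eq_mul_self (f s)
  exact ⟨c, hc, s, by rw [← h, hs]⟩

end WeakStar

/-! ### Evaluation functionals on scalar function spaces -/

section Evaluation

variable {𝕜 L : Type*} [RCLike 𝕜] [TopologicalSpace L] [CompactSpace L]

variable (S : Submodule 𝕜 C(L, 𝕜))

/-- The evaluation mapping into the weak* dual. -/
noncomputable def weakEval (l : L) : WeakDual 𝕜 S := StrongDual.toWeakDual (evalMap S l)

@[simp]
theorem weakEval_apply (l : L) (f : S) : weakEval S l f = (f : C(L, 𝕜)) l := rfl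

theorem continuous_weakEval : Continuous (weakEval S) :=
  WeakDual.continuous_of_continuous_eval fun f => (f : C(L, 𝕜)).continuous

theorem smul_weakEval_mem_weakBall {c : 𝕜} (hc : ‖c‖ = 1) (l : L) :
    c • weakEval S l ∈ weakBall 𝕜 S := by
  rw [mem_weakBall_iff]
  intro f
  change ‖c • (f : C(L, 𝕜)) l‖ ≤ _
  rw [norm_smul, hc, one_mul]
  exact (f : C(L, 𝕜)).norm_coe_le_norm l

theorem weakEval_mem_weakBall (l : L) : weakEval S l ∈ weakBall 𝕜 S := by
  simpa using smul_weakEval_mem_weakBall S (norm_one (α := 𝕜)) l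

theorem exists_norm_le_re_smul_weakEval [Nonempty L] (f : S) :
    ∃ c : 𝕜, ‖c‖ = 1 ∧ ∃ l, ‖f‖ ≤ RCLike.re ((c • weakEval S l) f) := by
  obtain ⟨c, hc, l, hl⟩ := exists_norm_one_mul_apply_eq_norm (f : C(L, 𝕜))
  refine ⟨c, hc, l, ?_⟩
  change _ ≤ RCLike.re (c * (f : C(L, 𝕜)) l)
  rw [hl, RCLike.ofReal_re]
  rfl

/-- Extreme points of the dual unit ball of a function space are rotated evaluations. -/
theorem exists_eq_smul_weakEval_of_mem_extremePoints [Nonempty L] {p : WeakDual 𝕜 S}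
    (hp : p ∈ (weakBall 𝕜 S).extremePoints ℝ) : ∃ c : 𝕜, ‖c‖ = 1 ∧ ∃ l, p = c • weakEval S l := by
  -- Rotated evaluations form a weak* compact set, norming because each function attains its norm;
  -- Milman's theorem then applies.
  let F : 𝕜 × L → WeakDual 𝕜 S := fun q => q.1 • weakEval S q.2
  have hF : Continuous F := WeakDual.continuous_of_continuous_eval fun f => by
    change Continuous fun q : 𝕜 × L => q.1 * (f : C(L, 𝕜)) q.2
    fun_prop
  have hA : IsCompact (F '' (Metric.sphere (0 : 𝕜) 1 ×ˢ Set.univ)) :=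
    ((isCompact_sphere (0 : 𝕜) 1).prod isCompact_univ).image hF
  have hsub : F '' (Metric.sphere (0 : 𝕜) 1 ×ˢ Set.univ) ⊆ weakBall 𝕜 S := by
    rintro _ ⟨⟨c, l⟩, ⟨hc, -⟩, rfl⟩
    exact smul_weakEval_mem_weakBall S (by simpa using hc) l
  have hpA := extremePoints_weakBall_subset hA hsub (fun f => by
    obtain ⟨c, hc, l, h⟩ := exists_norm_le_re_smul_weakEval S f
    exact ⟨_, ⟨(c, l), ⟨by simpa using hc, Set.mem_univ _⟩, rfl⟩, h⟩) hp
  obtain ⟨⟨c, l⟩, ⟨hc, -⟩, hcl⟩ := hpA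
  exact ⟨c, by simpa using hc, l, hcl.symm⟩

end Evaluation

/-- Mazur's theorem: convex hulls preserve total boundedness, and completeness does the rest. The
Banach hypothesis on $E$ enters here. -/
theorem isCompact_closure_convexHull {E : Type*} [NormedAddCommGroup E] [NormedSpace ℝ E]
    [CompleteSpace E] {A : Set E} (hA : IsCompact A) : IsCompact (closure (convexHull ℝ A)) :=
  isCompact_iff_totallyBounded_isComplete.2
    ⟨hA.totallyBounded.convexHull.closure, isClosed_closure.isComplete⟩

/-- Extreme points correspond to each other under an injective linear map. -/
theorem map_mem_extremePoints_image_iff {R V W : Type*} [Semiring R] [PartialOrder R]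
    [AddCommMonoid V] [AddCommMonoid W] [Module R V] [Module R W] (J : V →ₗ[R] W)
    (hJ : Function.Injective J) {s : Set V} {p : V} :
    J p ∈ (J '' s).extremePoints R ↔ p ∈ s.extremePoints R := by
  have hseg : ∀ x y, J p ∈ openSegment R (J x) (J y) ↔ p ∈ openSegment R x y := by
    intro x y
    constructor
    · rintro ⟨a, b, ha, hb, hab, h⟩
      exact ⟨a, b, ha, hb, hab, hJ (by simpa using h)⟩
    · rintro ⟨a, b, ha, hb, hab, rfl⟩
      exact ⟨a, b, ha, hb, hab, by simp⟩
  simp only [mem_extremePoints_iff_left, Set.forall_mem_image, hJ.mem_set_image, hseg, hJ.eq_iff]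

/-! ### Functionals on $H_w$ as operators $H\to E$ -/

section Operators

variable {𝕜 K E : Type*} [RCLike 𝕜] [TopologicalSpace K]
  [NormedAddCommGroup E] [NormedSpace 𝕜 E] {H : Submodule 𝕜 C(K, E)}

/-- The element `x^* ∘ f` of `H_w`. -/
noncomputable def weakComp (x : StrongDual 𝕜 E) (f : H) : weakSpace H :=
  ⟨(x : C(E, 𝕜)).comp f, Submodule.subset_span ⟨f, f.2, x, rfl⟩⟩

@[simp]
theorem weakComp_apply (x : StrongDual 𝕜 E) (f : H) (s : K) :
    (weakComp x f : C(K, 𝕜)) s = x ((f : C(K, E)) s) := rfl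

theorem weakComp_add_left (x y : StrongDual 𝕜 E) (f : H) :
    weakComp (x + y) f = weakComp x f + weakComp y f := rfl

theorem weakComp_smul_left (c : 𝕜) (x : StrongDual 𝕜 E) (f : H) :
    weakComp (c • x) f = c • weakComp x f := rfl

theorem weakComp_add_right (x : StrongDual 𝕜 E) (f g : H) :
    weakComp x (f + g) = weakComp x f + weakComp x g := by
  ext s
  simp

theorem weakComp_smul_right (c : 𝕜) (x : StrongDual 𝕜 E) (f : H) :
    weakComp x (c • f) = c • weakComp x f := by
  ext s
  simp

/-- Functionals on `H_w` are determined by their values on the generators. -/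
theorem ext_weakComp {p q : WeakDual 𝕜 (weakSpace H)}
    (h : ∀ x (f : H), p (weakComp x f) = q (weakComp x f)) : p = q := by
  refine DFunLike.ext _ _ fun g => ?_
  obtain ⟨g, hg⟩ := g
  induction hg using Submodule.span_induction with
  | mem g hg =>
    obtain ⟨f, hf, x, rfl⟩ := hg
    exact h x ⟨f, hf⟩
  | zero => exact (map_zero p).trans (map_zero q).symm
  | add a b ha hb iha ihb =>
    have := congrArg₂ (· + ·) iha ihb
    simp only [← map_add] at this
    exact this
  | smul c a ha iha =>
    have := congrArg (c • ·) iha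
    simp only [← map_smul] at this
    exact this

variable [CompactSpace K]

theorem norm_weakComp_le (x : StrongDual 𝕜 E) (f : H) : ‖weakComp x f‖ ≤ ‖x‖ * ‖f‖ := by
  refine (ContinuousMap.norm_le _ (by positivity)).2 fun s => ?_
  exact (x.le_opNorm _).trans
    (mul_le_mul_of_nonneg_left ((f : C(K, E)).norm_coe_le_norm s) (norm_nonneg x))

/-- The functional `x^* ↦ p (x^* ∘ f)` on `E^*`. -/
noncomputable def bidualOf (p : WeakDual 𝕜 (weakSpace H)) (f : H) :
    WeakDual 𝕜 (StrongDual 𝕜 E) :=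
  StrongDual.toWeakDual <| LinearMap.mkContinuous
    { toFun := fun x => p (weakComp x f)
      map_add' := fun x y => by rw [weakComp_add_left, map_add]
      map_smul' := fun c x => by rw [weakComp_smul_left, map_smul, RingHom.id_apply] }
    (‖WeakDual.toStrongDual p‖ * ‖f‖) fun x => by
      refine ((WeakDual.toStrongDual p).le_opNorm _).trans ?_
      rw [mul_assoc, mul_comm ‖f‖]
      exact mul_le_mul_of_nonneg_left (norm_weakComp_le x f) (norm_nonneg _)

/-- The canonical embedding of `E` into its bidual with the weak* topology. -/
noncomputable def weakBidual : E →ₗ[𝕜] WeakDual 𝕜 (StrongDual 𝕜 E) :=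
  StrongDual.toWeakDual.toLinearMap ∘ₗ (NormedSpace.inclusionInDoubleDual 𝕜 E).toLinearMap

@[simp]
theorem weakBidual_apply (y : E) (x : StrongDual 𝕜 E) : weakBidual y x = x y := rfl

theorem continuous_weakBidual :
    Continuous (weakBidual : E → WeakDual 𝕜 (StrongDual 𝕜 E)) :=
  WeakDual.continuous_of_continuous_eval fun x => x.continuous

variable [CompleteSpace E]

/-- A functional in the dual unit ball of `H_w` is represented by vectors of `E`, by compactness
of the closed convex hull of the compact set of rotations of `f(K)`. -/
theorem exists_forall_apply_eq_of_mem_weakBall [Nonempty K] {p : WeakDual 𝕜 (weakSpace H)}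
    (hp : p ∈ weakBall 𝕜 (weakSpace H)) (f : H) :
    ∃ y : E, ∀ x : StrongDual 𝕜 E, x y = p (weakComp x f) := by
  let : NormedSpace ℝ E := NormedSpace.restrictScalars ℝ 𝕜 E
  let F : 𝕜 × K → E := fun q => q.1 • (f : C(K, E)) q.2
  have hF : Continuous F := by fun_prop
  let A : Set E := F '' (Metric.sphere (0 : 𝕜) 1 ×ˢ Set.univ)
  have hA : IsCompact A := ((isCompact_sphere (0 : 𝕜) 1).prod isCompact_univ).image hF
  let Q : Set E := closure (convexHull ℝ A)
  have hQ : IsCompact Q := isCompact_closure_convexHull hA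
  have hQconv : Convex 𝕜 Q := convex_RCLike_iff_convex_real.2 (convex_convexHull ℝ A).closure
  have hQ' : Convex ℝ (weakBidual (𝕜 := 𝕜) '' Q) :=
    convex_weakDual_iff.1 (hQconv.linear_image weakBidual)
  -- Norm compactness of `Q` makes its copy in the bidual weak* closed, so separation only has to be
  -- tested against elements of $E^*$.
  have hclosed : IsClosed (weakBidual (𝕜 := 𝕜) '' Q) :=
    (hQ.image continuous_weakBidual).isClosed
  have hmem : bidualOf p f ∈ weakBidual (𝕜 := 𝕜) '' Q := by
    refine mem_of_forall_exists_re_le hQ' hclosed fun x => ?_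
    obtain ⟨c, hc, s, hs⟩ := exists_norm_one_mul_apply_eq_norm (weakComp x f : C(K, 𝕜))
    refine ⟨_, ⟨F (c, s), subset_closure (subset_convexHull ℝ A
      ⟨(c, s), ⟨by simpa using hc, Set.mem_univ _⟩, rfl⟩), rfl⟩, ?_⟩
    have hval : weakBidual (F (c, s)) x = (‖weakComp x f‖ : 𝕜) := by
      rw [weakBidual_apply, map_smul, smul_eq_mul]
      exact hs
    rw [hval, RCLike.ofReal_re]
    exact (RCLike.re_le_norm _).trans (mem_weakBall_iff.1 hp _)
  obtain ⟨y, -, hy⟩ := hmem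
  exact ⟨y, fun x => DFunLike.congr_fun hy x⟩

theorem exists_forall_apply_eq [Nonempty K] (p : WeakDual 𝕜 (weakSpace H)) (f : H) :
    ∃ y : E, ∀ x : StrongDual 𝕜 E, x y = p (weakComp x f) := by
  -- The added 1 keeps `r` positive when `p = 0`.
  let r : ℝ := ‖WeakDual.toStrongDual p‖ + 1
  have hr : 0 < r := by positivity
  have hmem : ((r⁻¹ : ℝ) : 𝕜) • p ∈ weakBall 𝕜 (weakSpace H) := by
    rw [mem_weakBall_iff]
    intro g
    change ‖((r⁻¹ : ℝ) : 𝕜) • p g‖ ≤ _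
    rw [norm_smul, RCLike.norm_ofReal, abs_of_pos (inv_pos.2 hr)]
    refine inv_mul_le_of_le_mul₀ hr.le (norm_nonneg _) ?_
    refine ((WeakDual.toStrongDual p).le_opNorm g).trans ?_
    exact mul_le_mul_of_nonneg_right (le_add_of_nonneg_right zero_le_one) (norm_nonneg _)
  obtain ⟨y, hy⟩ := exists_forall_apply_eq_of_mem_weakBall hmem f
  refine ⟨(r : 𝕜) • y, fun x => ?_⟩
  rw [map_smul, hy]
  change (r : 𝕜) • ((r⁻¹ : ℝ) : 𝕜) • p (weakComp x f) = _
  rw [smul_smul, ← RCLike.ofReal_mul, mul_inv_cancel₀ hr.ne', RCLike.ofReal_one, one_smul]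

variable [Nonempty K]

/-- The operator `H → E` represented by a functional on `H_w`. -/
noncomputable def reprOp (p : WeakDual 𝕜 (weakSpace H)) : H →WOT[𝕜] E :=
  ContinuousLinearMapWOT.ofCLM <| LinearMap.mkContinuous
    { toFun := fun f => (exists_forall_apply_eq p f).choose
      -- The chosen vector is determined by its pairings with $E^*$, so linearity can be checked
      -- there.
      map_add' := fun f g => by
        refine (SeparatingDual.eq_iff_forall_dual_eq (R := 𝕜)).2 fun x => ?_
        rw [map_add, (exists_forall_apply_eq p _).choose_spec,
          (exists_forall_apply_eq p _).choose_spec, (exists_forall_apply_eq p _).choose_spec,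
          weakComp_add_right, map_add]
      map_smul' := fun c f => by
        refine (SeparatingDual.eq_iff_forall_dual_eq (R := 𝕜)).2 fun x => ?_
        rw [map_smul, (exists_forall_apply_eq p _).choose_spec,
          (exists_forall_apply_eq p _).choose_spec, weakComp_smul_right, map_smul]
        rfl }
    ‖WeakDual.toStrongDual p‖ fun f => by
      refine NormedSpace.norm_le_dual_bound 𝕜 _ (by positivity) fun x => ?_
      change ‖x (exists_forall_apply_eq p f).choose‖ ≤ _
      rw [(exists_forall_apply_eq p f).choose_spec]
      refine ((WeakDual.toStrongDual p).le_opNorm _).trans ?_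
      rw [mul_assoc, mul_comm ‖f‖]
      exact mul_le_mul_of_nonneg_left (norm_weakComp_le x f) (norm_nonneg _)

theorem apply_reprOp (p : WeakDual 𝕜 (weakSpace H)) (f : H) (x : StrongDual 𝕜 E) :
    x (reprOp p f) = p (weakComp x f) :=
  (exists_forall_apply_eq p f).choose_spec x

/-- `reprOp` as a linear map. -/
noncomputable def reprOpₗ : StrongDual 𝕜 (weakSpace H) →ₗ[𝕜] (H →WOT[𝕜] E) where
  toFun p := reprOp (StrongDual.toWeakDual p)
  map_add' p q := by
    refine ContinuousLinearMapWOT.ext_dual fun f x => ?_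
    rw [ContinuousLinearMapWOT.add_apply, map_add x, apply_reprOp, apply_reprOp, apply_reprOp]
    rfl
  map_smul' c p := by
    refine ContinuousLinearMapWOT.ext_dual fun f x => ?_
    rw [RingHom.id_apply, ContinuousLinearMapWOT.smul_apply, map_smul x, apply_reprOp, apply_reprOp]
    rfl

theorem apply_reprOpₗ (p : StrongDual 𝕜 (weakSpace H)) (f : H) (x : StrongDual 𝕜 E) :
    x (reprOpₗ p f) = p (weakComp x f) :=
  apply_reprOp _ f x

theorem reprOpₗ_injective :
    Function.Injective (reprOpₗ : StrongDual 𝕜 (weakSpace H) →ₗ[𝕜] (H →WOT[𝕜] E)) := by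
  intro p q h
  refine StrongDual.toWeakDual.injective (ext_weakComp fun x f => ?_)
  rw [StrongDual.toWeakDual_apply, StrongDual.toWeakDual_apply, ← apply_reprOpₗ, h, apply_reprOpₗ]

theorem reprOpₗ_evalMap (s : K) :
    reprOpₗ (evalMap (weakSpace H) s) = ContinuousLinearMapWOT.ofCLM (evalMap H s) := by
  refine ContinuousLinearMapWOT.ext_dual fun f x => ?_
  rw [apply_reprOpₗ]
  rfl

theorem continuous_reprOp :
    Continuous (reprOp : WeakDual 𝕜 (weakSpace H) → (H →WOT[𝕜] E)) := by
  refine ContinuousLinearMapWOT.continuous_of_dual_apply_continuous fun f x => ?_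
  simp only [apply_reprOp]
  exact WeakDual.eval_continuous _

/-- The dual unit ball of `H_w` corresponds to the closed absolutely convex hull of `φ_H(K)`. -/
theorem image_reprOpₗ_closedBall :
    reprOpₗ '' Metric.closedBall (0 : StrongDual 𝕜 (weakSpace H)) 1 = wotClosedHull H := by
  apply Set.Subset.antisymm
  · have habs : AbsConvex 𝕜 (wotClosedHull H) := absConvex_absConvexHull.closure
    have hmem : ∀ s, ContinuousLinearMapWOT.ofCLM (evalMap H s) ∈ wotClosedHull H := fun s =>
      subset_closure (subset_absConvexHull ⟨s, rfl⟩)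
    -- The preimage of the hull is weak* closed, convex and contains all rotated evaluations; being
    -- norming, it contains the ball.
    have hconv : Convex ℝ ((reprOp : WeakDual 𝕜 (weakSpace H) → _) ⁻¹' wotClosedHull H) :=
      convex_weakDual_iff.1
        (habs.2.linear_preimage (reprOpₗ.comp WeakDual.toStrongDual.toLinearMap))
    have hsub := weakBall_subset_of_forall_exists_norm_le hconv
      (isClosed_closure.preimage continuous_reprOp) fun g => by
        obtain ⟨c, hc, s, h⟩ := exists_norm_le_re_smul_weakEval (weakSpace H) g
        refine ⟨_, ?_, h⟩
        have hcs : reprOp (c • weakEval (weakSpace H) s) =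
            c • ContinuousLinearMapWOT.ofCLM (evalMap H s) := by
          rw [← reprOpₗ_evalMap, ← map_smul]
          rfl
        rw [Set.mem_preimage, hcs]
        exact habs.1.smul_mem hc.le (hmem s)
    rintro _ ⟨p, hp, rfl⟩
    exact hsub (show StrongDual.toWeakDual p ∈ weakBall 𝕜 (weakSpace H) from hp)
  · have himage : reprOpₗ '' Metric.closedBall (0 : StrongDual 𝕜 (weakSpace H)) 1 =
        reprOp '' weakBall 𝕜 (weakSpace H) := rfl
    have hball := absConvex_closedBall_strongDual (𝕜 := 𝕜) (X := weakSpace H)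
    refine closure_minimal (absConvexHull_min ?_ ⟨?_, ?_⟩) ?_
    · rintro _ ⟨s, rfl⟩
      exact ⟨evalMap (weakSpace H) s, weakEval_mem_weakBall (weakSpace H) s, reprOpₗ_evalMap s⟩
    · rintro c hc _ ⟨_, ⟨p, hp, rfl⟩, rfl⟩
      exact ⟨c • p, hball.1.smul_mem hc hp, reprOpₗ.map_smul c p⟩
    · rintro _ ⟨p, hp, rfl⟩ _ ⟨q, hq, rfl⟩ a b ha hb hab
      refine ⟨a • p + b • q, hball.2 hp hq ha hb hab, ?_⟩
      rw [reprOpₗ.map_add, reprOpₗ.map_smul, reprOpₗ.map_smul]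
    -- Closedness comes from weak* compactness of the ball and weak*-to-WOT continuity of `reprOp`.
    · rw [himage]
      exact (isCompact_weakBall.image continuous_reprOp).isClosed

theorem ofCLM_evalMap_mem_extremePoints_iff (t : K) :
    ContinuousLinearMapWOT.ofCLM (evalMap H t) ∈ (wotClosedHull H).extremePoints 𝕜 ↔
      evalMap (weakSpace H) t ∈ extDualBall 𝕜 (weakSpace H) := by
  rw [← image_reprOpₗ_closedBall, ← reprOpₗ_evalMap]
  exact map_mem_extremePoints_image_iff reprOpₗ reprOpₗ_injective

end Operators

/-! ### Adjoints of contractions and faces of dual balls -/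

section Adjoint

variable {𝕜 X Y : Type*} [RCLike 𝕜] [NormedAddCommGroup X] [NormedSpace 𝕜 X]
  [NormedAddCommGroup Y] [NormedSpace 𝕜 Y]

theorem mem_extremePoints_weakBall_iff {p : WeakDual 𝕜 X} :
    p ∈ (weakBall 𝕜 X).extremePoints ℝ ↔ p ∈ weakBall 𝕜 X ∧ ∀ q ∈ weakBall 𝕜 X,
      ∀ r ∈ weakBall 𝕜 X, p ∈ openSegment ℝ q r → q = p :=
  mem_extremePoints_iff_left

theorem zero_mem_weakBall : (0 : WeakDual 𝕜 X) ∈ weakBall 𝕜 X :=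
  mem_weakBall_iff.2 fun x => by
    change ‖(0 : 𝕜)‖ ≤ ‖x‖
    simp

/-- The adjoint of a continuous linear map, on weak* duals. -/
noncomputable def weakAdjoint (R : X →L[𝕜] Y) (p : WeakDual 𝕜 Y) : WeakDual 𝕜 X :=
  StrongDual.toWeakDual ((WeakDual.toStrongDual p).comp R)

@[simp]
theorem weakAdjoint_apply (R : X →L[𝕜] Y) (p : WeakDual 𝕜 Y) (x : X) :
    weakAdjoint R p x = p (R x) := rfl

theorem weakAdjoint_mem_weakBall {R : X →L[𝕜] Y} (hR : ∀ x, ‖R x‖ ≤ ‖x‖)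
    {p : WeakDual 𝕜 Y} (hp : p ∈ weakBall 𝕜 Y) : weakAdjoint R p ∈ weakBall 𝕜 X :=
  mem_weakBall_iff.2 fun x => (mem_weakBall_iff.1 hp (R x)).trans (hR x)

theorem weakAdjoint_mem_openSegment (R : X →L[𝕜] Y) {p q r : WeakDual 𝕜 Y}
    (h : p ∈ openSegment ℝ q r) :
    weakAdjoint R p ∈ openSegment ℝ (weakAdjoint R q) (weakAdjoint R r) := by
  obtain ⟨a, b, ha, hb, hab, rfl⟩ := h
  exact ⟨a, b, ha, hb, hab, rfl⟩

theorem continuous_weakAdjoint (R : X →L[𝕜] Y) :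
    Continuous (weakAdjoint R : WeakDual 𝕜 Y → WeakDual 𝕜 X) :=
  WeakDual.continuous_of_continuous_eval fun x => WeakDual.eval_continuous (R x)

/-- The adjoint of a contraction with a right inverse reflects extreme points. -/
theorem mem_extremePoints_of_weakAdjoint {R : X →L[𝕜] Y} {S : Y →L[𝕜] X} (hR : ∀ x, ‖R x‖ ≤ ‖x‖)
    (hRS : ∀ y, R (S y) = y) {p : WeakDual 𝕜 Y} (hp : p ∈ weakBall 𝕜 Y)
    (h : weakAdjoint R p ∈ (weakBall 𝕜 X).extremePoints ℝ) :
    p ∈ (weakBall 𝕜 Y).extremePoints ℝ := by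
  rw [mem_extremePoints_weakBall_iff] at h ⊢
  refine ⟨hp, fun q hq r hr hpq => ?_⟩
  have heq := h.2 _ (weakAdjoint_mem_weakBall hR hq) _ (weakAdjoint_mem_weakBall hR hr)
    (weakAdjoint_mem_openSegment R hpq)
  refine DFunLike.ext _ _ fun y => ?_
  have := DFunLike.congr_fun heq (S y)
  rwa [weakAdjoint_apply, weakAdjoint_apply, hRS] at this

/-- The adjoint maps one ball linearly into the other, and the preimage of an extreme point under
such a map is a face. -/
theorem isExtreme_weakBall_inter_weakAdjoint_fiber {R : X →L[𝕜] Y} (hR : ∀ x, ‖R x‖ ≤ ‖x‖)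
    {p : WeakDual 𝕜 X} (hp : p ∈ (weakBall 𝕜 X).extremePoints ℝ) :
    IsExtreme ℝ (weakBall 𝕜 Y) {P ∈ weakBall 𝕜 Y | weakAdjoint R P = p} := by
  rw [mem_extremePoints_weakBall_iff] at hp
  refine ⟨fun P hP => hP.1, fun P hP Q hQ S hS hPQ => ⟨hP, ?_⟩⟩
  refine hp.2 _ (weakAdjoint_mem_weakBall hR hP) _ (weakAdjoint_mem_weakBall hR hQ) ?_
  rw [← hS.2]
  exact weakAdjoint_mem_openSegment R hPQ

theorem isCompact_weakBall_inter_weakAdjoint_fiber (R : X →L[𝕜] Y) (p : WeakDual 𝕜 X) :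
    IsCompact {P ∈ weakBall 𝕜 Y | weakAdjoint R P = p} :=
  isCompact_weakBall.inter_right (isClosed_eq (continuous_weakAdjoint R) continuous_const)

theorem convex_weakBall_inter_weakAdjoint_fiber (R : X →L[𝕜] Y) (p : WeakDual 𝕜 X) :
    Convex ℝ {P ∈ weakBall 𝕜 Y | weakAdjoint R P = p} := by
  intro P hP Q hQ a b ha hb hab
  refine ⟨convex_weakBall hP.1 hQ.1 ha hb hab, ?_⟩
  have h : weakAdjoint R (a • P + b • Q) = a • weakAdjoint R P + b • weakAdjoint R Q := rfl
  rw [h, hP.2, hQ.2, weakDual_combo_self _ hab]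

theorem mem_extremePoints_of_isExtreme {C F : Set (WeakDual 𝕜 X)} (hF : IsExtreme ℝ C F)
    {p : WeakDual 𝕜 X} (hp : p ∈ F.extremePoints ℝ) : p ∈ C.extremePoints ℝ :=
  hF.extremePoints_subset_extremePoints hp

end Adjoint

/-! ### The space $H_s$: slices, extensions and faces -/

section Strong

variable {𝕜 K E : Type*} [RCLike 𝕜] [TopologicalSpace K]
  [NormedAddCommGroup E] [NormedSpace 𝕜 E] {H : Submodule 𝕜 C(K, E)}

theorem exists_forall_apply_eq_of_mem_strongSpace {h : C(K × DualBall 𝕜 E, 𝕜)}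
    (hh : h ∈ strongSpace H) : ∃ f ∈ H, ∃ g ∈ weakSpace H,
      ∀ (s : K) (x : DualBall 𝕜 E), h (s, x) = (x : WeakDual 𝕜 E) (f s) + g s := by
  obtain ⟨_, ⟨f, hf, rfl⟩, _, ⟨g, hg, rfl⟩, rfl⟩ := Submodule.mem_sup.1 hh
  exact ⟨f, hf, g, hg, fun s x => rfl⟩

theorem opT_mem_strongSpace {f : C(K, E)} (hf : f ∈ H) : opT f ∈ strongSpace H :=
  Submodule.mem_sup_left ⟨f, hf, rfl⟩

theorem compFst_mem_strongSpace {g : C(K, 𝕜)} (hg : g ∈ weakSpace H) :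
    compFst g ∈ strongSpace H :=
  Submodule.mem_sup_right ⟨g, hg, rfl⟩

/-- The slice `s ↦ (s, x)`. -/
def slice (x : DualBall 𝕜 E) : C(K, K × DualBall 𝕜 E) := ⟨fun s => (s, x), by fun_prop⟩

theorem comp_slice_mem_weakSpace {h : C(K × DualBall 𝕜 E, 𝕜)} (hh : h ∈ strongSpace H)
    (x : DualBall 𝕜 E) : h.comp (slice x) ∈ weakSpace H := by
  obtain ⟨f, hf, g, hg, hfg⟩ := exists_forall_apply_eq_of_mem_strongSpace hh
  have heq : h.comp (slice x) = (WeakDual.toStrongDual (x : WeakDual 𝕜 E) : C(E, 𝕜)).comp f + g := by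
    ext s
    exact hfg s x
  rw [heq]
  exact (weakSpace H).add_mem (Submodule.subset_span ⟨f, hf, _, rfl⟩) hg

variable (H) in
/-- The functionals in `B_{E^*}` that agree with `y` on `H(t)`. -/
def agreementFace (t : K) (y : WeakDual 𝕜 E) : Set (WeakDual 𝕜 E) :=
  {x ∈ weakBall 𝕜 E | ∀ f ∈ H, x (f t) = y (f t)}

theorem isCompact_agreementFace (t : K) (y : WeakDual 𝕜 E) :
    IsCompact (agreementFace H t y) := by
  have hclosed : IsClosed {x : WeakDual 𝕜 E | ∀ f ∈ H, x (f t) = y (f t)} := by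
    simp only [Set.ofPred_forall]
    exact isClosed_biInter fun f _ => isClosed_eq (WeakDual.eval_continuous (f t)) continuous_const
  exact isCompact_weakBall.inter_right hclosed

variable [CompactSpace K]

variable (H) in
/-- Restriction `H_s → H_w` to the slice `K × {x}`. -/
noncomputable def restrictSlice (x : DualBall 𝕜 E) : strongSpace H →L[𝕜] weakSpace H :=
  LinearMap.mkContinuous
    { toFun := fun h => ⟨(h : C(K × DualBall 𝕜 E, 𝕜)).comp (slice x),
        comp_slice_mem_weakSpace h.2 x⟩
      map_add' := fun _ _ => rfl
      map_smul' := fun _ _ => rfl } 1 fun h => by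
    rw [one_mul]
    exact (ContinuousMap.norm_le _ (norm_nonneg _)).2 fun s =>
      (h : C(K × DualBall 𝕜 E, 𝕜)).norm_coe_le_norm (s, x)

theorem norm_restrictSlice_le (x : DualBall 𝕜 E) (h : strongSpace H) :
    ‖restrictSlice H x h‖ ≤ ‖h‖ :=
  (ContinuousMap.norm_le _ (norm_nonneg _)).2 fun s =>
    (h : C(K × DualBall 𝕜 E, 𝕜)).norm_coe_le_norm (s, x)

variable (H) in
/-- The embedding `H_w → H_s`, `g ↦ g ∘ π₁`. -/
noncomputable def liftFst : weakSpace H →L[𝕜] strongSpace H :=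
  LinearMap.mkContinuous
    { toFun := fun g => ⟨compFst (g : C(K, 𝕜)), compFst_mem_strongSpace g.2⟩
      map_add' := fun _ _ => rfl
      map_smul' := fun _ _ => rfl } 1 fun g => by
    rw [one_mul]
    exact (ContinuousMap.norm_le _ (norm_nonneg _)).2 fun s =>
      (g : C(K, 𝕜)).norm_coe_le_norm s.1

theorem norm_liftFst_le (g : weakSpace H) : ‖liftFst H g‖ ≤ ‖g‖ :=
  (ContinuousMap.norm_le _ (norm_nonneg _)).2 fun s => (g : C(K, 𝕜)).norm_coe_le_norm s.1

theorem restrictSlice_liftFst (x : DualBall 𝕜 E) (g : weakSpace H) :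
    restrictSlice H x (liftFst H g) = g := rfl

theorem weakAdjoint_liftFst_weakEval (x : DualBall 𝕜 E) (t : K) :
    weakAdjoint (liftFst H) (weakEval (strongSpace H) (t, x)) = weakEval (weakSpace H) t := rfl

/-- The adjoint of restriction to the slice at `x` sends $\phi_{H_w}(t)$ to $\phi_{H_s}(t,x)$, and
it reflects extreme points because `liftFst` is a right inverse of the restriction. -/
theorem weakEval_mem_extremePoints_of_strong {t : K} {x : DualBall 𝕜 E}
    (h : weakEval (strongSpace H) (t, x) ∈ (weakBall 𝕜 (strongSpace H)).extremePoints ℝ) :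
    weakEval (weakSpace H) t ∈ (weakBall 𝕜 (weakSpace H)).extremePoints ℝ :=
  mem_extremePoints_of_weakAdjoint (R := restrictSlice H x) (S := liftFst H)
    (norm_restrictSlice_le x) (restrictSlice_liftFst x) (weakEval_mem_weakBall _ t) h

variable (H) in
/-- The functionals in the dual unit ball of `H_s` that extend `φ_{H_w}(t)`. -/
def extensionFace (t : K) : Set (WeakDual 𝕜 (strongSpace H)) :=
  {P ∈ weakBall 𝕜 (strongSpace H) | weakAdjoint (liftFst H) P = weakEval (weakSpace H) t}

theorem isCompact_extensionFace (t : K) : IsCompact (extensionFace H t) :=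
  isCompact_weakBall_inter_weakAdjoint_fiber (liftFst H) _

theorem convex_extensionFace (t : K) : Convex ℝ (extensionFace H t) :=
  convex_weakBall_inter_weakAdjoint_fiber (liftFst H) _

theorem weakEval_mem_extensionFace (t : K) (x : DualBall 𝕜 E) :
    weakEval (strongSpace H) (t, x) ∈ extensionFace H t :=
  ⟨weakEval_mem_weakBall _ _, weakAdjoint_liftFst_weakEval x t⟩

theorem isExtreme_extensionFace {t : K}
    (ht : weakEval (weakSpace H) t ∈ (weakBall 𝕜 (weakSpace H)).extremePoints ℝ) :
    IsExtreme ℝ (weakBall 𝕜 (strongSpace H)) (extensionFace H t) :=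
  isExtreme_weakBall_inter_weakAdjoint_fiber (R := liftFst H) norm_liftFst_le ht

/-- The extreme points of the face are evaluations at points of `{t} × B_{E^*}`. -/
theorem exists_eq_weakEval_of_mem_extremePoints_extensionFace {t : K}
    (ht : weakEval (weakSpace H) t ∈ (weakBall 𝕜 (weakSpace H)).extremePoints ℝ)
    {P : WeakDual 𝕜 (strongSpace H)} (hP : P ∈ (extensionFace H t).extremePoints ℝ) :
    ∃ x : DualBall 𝕜 E, P = weakEval (strongSpace H) (t, x) := by
  have : Nonempty (K × DualBall 𝕜 E) := ⟨(t, ⟨0, zero_mem_weakBall⟩)⟩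
  have hP' := mem_extremePoints_of_isExtreme (isExtreme_extensionFace ht) hP
  obtain ⟨c, -, ⟨s, x⟩, rfl⟩ := exists_eq_smul_weakEval_of_mem_extremePoints (strongSpace H) hP'
  -- Composing this identity on $H_w$ with restriction to the slice at `x` gives
  -- $c\,\phi_{H_s}(s,x)=\phi_{H_s}(t,x)$, which absorbs both `c` and `s`.
  have hres : c • weakEval (weakSpace H) s = weakEval (weakSpace H) t := hP.1.2
  exact ⟨x, congrArg (weakAdjoint (restrictSlice H x)) hres⟩

/-- Evaluation at `(t, x)` is affine in `x`. -/
theorem weakEval_smul_add_smul (t : K) {x y z : DualBall 𝕜 E} {a b : ℝ} (hab : a + b = 1)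
    (hx : a • (y : WeakDual 𝕜 E) + b • (z : WeakDual 𝕜 E) = x) :
    a • weakEval (strongSpace H) (t, y) + b • weakEval (strongSpace H) (t, z) =
      weakEval (strongSpace H) (t, x) := by
  refine DFunLike.ext _ _ fun k => ?_
  obtain ⟨f, hf, g, -, hfg⟩ := exists_forall_apply_eq_of_mem_strongSpace k.2
  have hxf : (x : WeakDual 𝕜 E) (f t) =
      a • (y : WeakDual 𝕜 E) (f t) + b • (z : WeakDual 𝕜 E) (f t) := by
    rw [← hx]
    rfl
  change a • (k : C(K × DualBall 𝕜 E, 𝕜)) (t, y) + b • (k : C(K × DualBall 𝕜 E, 𝕜)) (t, z) =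
    (k : C(K × DualBall 𝕜 E, 𝕜)) (t, x)
  rw [hfg, hfg, hfg, hxf]
  have hg : g t = a • g t + b • g t := by rw [← add_smul, hab, one_smul]
  conv_rhs => rw [hg]
  rw [smul_add, smul_add]
  abel

theorem weakEval_mem_openSegment (t : K) {x y z : DualBall 𝕜 E}
    (h : (x : WeakDual 𝕜 E) ∈ openSegment ℝ (y : WeakDual 𝕜 E) (z : WeakDual 𝕜 E)) :
    weakEval (strongSpace H) (t, x) ∈ openSegment ℝ (weakEval (strongSpace H) (t, y))
      (weakEval (strongSpace H) (t, z)) := by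
  obtain ⟨a, b, ha, hb, hab, hx⟩ := h
  exact ⟨a, b, ha, hb, hab, weakEval_smul_add_smul t hab hx⟩

theorem weakEval_strongSpace_eq_iff {t : K} {x y : DualBall 𝕜 E} :
    weakEval (strongSpace H) (t, x) = weakEval (strongSpace H) (t, y) ↔
      ∀ f ∈ H, (x : WeakDual 𝕜 E) (f t) = (y : WeakDual 𝕜 E) (f t) := by
  constructor
  · intro h f hf
    exact DFunLike.congr_fun h ⟨opT f, opT_mem_strongSpace hf⟩
  · intro h
    refine DFunLike.ext _ _ fun k => ?_
    obtain ⟨f, hf, g, -, hfg⟩ := exists_forall_apply_eq_of_mem_strongSpace k.2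
    rw [weakEval_apply, weakEval_apply, hfg, hfg, h f hf]

/-- The face is the preimage of the extreme point $\phi_{H_s}(t,y)$ under the affine map
$x\mapsto\phi_{H_s}(t,x)$. -/
theorem isExtreme_agreementFace {t : K} {y : DualBall 𝕜 E}
    (hy : weakEval (strongSpace H) (t, y) ∈ (weakBall 𝕜 (strongSpace H)).extremePoints ℝ) :
    IsExtreme ℝ (weakBall 𝕜 E) (agreementFace H t y) := by
  refine ⟨fun x hx => hx.1, fun p hp q hq x hx hpq => ⟨hp, ?_⟩⟩
  have hseg := weakEval_mem_openSegment (H := H) t (x := ⟨x, hx.1⟩) (y := ⟨p, hp⟩)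
    (z := ⟨q, hq⟩) hpq
  have hxy : weakEval (strongSpace H) (t, ⟨x, hx.1⟩) = weakEval (strongSpace H) (t, y) :=
    weakEval_strongSpace_eq_iff.2 hx.2
  rw [hxy] at hseg
  have hpy := (mem_extremePoints_weakBall_iff.1 hy).2 _ (weakEval_mem_weakBall _ _) _
    (weakEval_mem_weakBall _ _) hseg
  exact weakEval_strongSpace_eq_iff.1 hpy

theorem exists_weakEval_mem_extremePoints {t : K}
    (ht : weakEval (weakSpace H) t ∈ (weakBall 𝕜 (weakSpace H)).extremePoints ℝ) :
    ∃ y : DualBall 𝕜 E,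
      weakEval (strongSpace H) (t, y) ∈ (weakBall 𝕜 (strongSpace H)).extremePoints ℝ := by
  have hne : (extensionFace H t).Nonempty :=
    ⟨_, weakEval_mem_extensionFace t ⟨0, zero_mem_weakBall⟩⟩
  have hex := exists_mem_extremePoints_of_isCompact (isCompact_extensionFace (H := H) t) hne
  obtain ⟨P, hP⟩ := hex
  obtain ⟨y, rfl⟩ := exists_eq_weakEval_of_mem_extremePoints_extensionFace ht hP
  exact ⟨y, mem_extremePoints_of_isExtreme (isExtreme_extensionFace ht) hP⟩

/-- If `φ_{H_w}(t)` is extreme, then so is `φ_{H_s}(t, e)` for some extreme point `e`. -/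
theorem exists_mem_extremePoints_weakEval_mem_extremePoints {t : K}
    (ht : weakEval (weakSpace H) t ∈ (weakBall 𝕜 (weakSpace H)).extremePoints ℝ) :
    ∃ e : DualBall 𝕜 E, (e : WeakDual 𝕜 E) ∈ (weakBall 𝕜 E).extremePoints ℝ ∧
      weakEval (strongSpace H) (t, e) ∈ (weakBall 𝕜 (strongSpace H)).extremePoints ℝ := by
  obtain ⟨y, hy⟩ := exists_weakEval_mem_extremePoints ht
  have hex := exists_mem_extremePoints_of_isCompact
    (isCompact_agreementFace (H := H) t (y : WeakDual 𝕜 E)) ⟨y, y.2, fun f _ => rfl⟩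
  obtain ⟨e, he⟩ := hex
  refine ⟨⟨e, he.1.1⟩, mem_extremePoints_of_isExtreme (isExtreme_agreementFace hy) he, ?_⟩
  -- Passing from `y` to the extreme point `e` does not change the evaluation, since the two agree
  -- on $H(t)$.
  have hey : weakEval (strongSpace H) (t, ⟨e, he.1.1⟩) = weakEval (strongSpace H) (t, y) :=
    weakEval_strongSpace_eq_iff.2 he.1.2
  rw [hey]
  exact hy

theorem continuous_weakEval_prodMk (t : K) :
    Continuous fun x : DualBall 𝕜 E => weakEval (strongSpace H) (t, x) :=
  (continuous_weakEval (strongSpace H)).comp (by fun_prop)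

/-- The face consists of the evaluations at points of `{t} × B_{E^*}`. -/
theorem extensionFace_subset_range {t : K}
    (ht : weakEval (weakSpace H) t ∈ (weakBall 𝕜 (weakSpace H)).extremePoints ℝ) :
    extensionFace H t ⊆ Set.range fun x : DualBall 𝕜 E => weakEval (strongSpace H) (t, x) := by
  have hcompact := isCompact_range (continuous_weakEval_prodMk (H := H) t)
  have hconv : Convex ℝ
      (Set.range fun x : DualBall 𝕜 E => weakEval (strongSpace H) (t, x)) := by
    rintro _ ⟨x, rfl⟩ _ ⟨y, rfl⟩ a b ha hb hab
    refine ⟨⟨a • (x : WeakDual 𝕜 E) + b • (y : WeakDual 𝕜 E),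
      convex_weakBall x.2 y.2 ha hb hab⟩, ?_⟩
    exact (weakEval_smul_add_smul t hab rfl).symm
  refine subset_of_extremePoints_subset_weakDual (isCompact_extensionFace t)
    (convex_extensionFace t) hcompact.isClosed hconv fun P hP => ?_
  obtain ⟨x, rfl⟩ := exists_eq_weakEval_of_mem_extremePoints_extensionFace ht hP
  exact ⟨x, rfl⟩

theorem weakEval_mem_extremePoints_of_dense {t : K} (hdense : Dense {y : E | ∃ f ∈ H, f t = y})
    (ht : weakEval (weakSpace H) t ∈ (weakBall 𝕜 (weakSpace H)).extremePoints ℝ)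
    {e : DualBall 𝕜 E} (he : (e : WeakDual 𝕜 E) ∈ (weakBall 𝕜 E).extremePoints ℝ) :
    weakEval (strongSpace H) (t, e) ∈ (weakBall 𝕜 (strongSpace H)).extremePoints ℝ := by
  refine mem_extremePoints_weakBall_iff.2 ⟨weakEval_mem_weakBall _ _, fun P hP Q hQ hPQ => ?_⟩
  have hface := isExtreme_extensionFace ht
  -- Both endpoints lie in the face, hence are themselves evaluations over `t`.
  have hPF := hface.left_mem_of_mem_openSegment hP hQ (weakEval_mem_extensionFace t e) hPQ
  have hQF := hface.right_mem_of_mem_openSegment hP hQ (weakEval_mem_extensionFace t e) hPQ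
  obtain ⟨x, rfl⟩ := extensionFace_subset_range ht hPF
  obtain ⟨y, rfl⟩ := extensionFace_subset_range ht hQF
  obtain ⟨a, b, ha, hb, hab, h⟩ := hPQ
  -- Testing on `opT f` gives equality on $H(t)$; density and continuity extend it to $E$.
  have heq : a • (x : WeakDual 𝕜 E) + b • (y : WeakDual 𝕜 E) = e := by
    refine DFunLike.coe_injective (Continuous.ext_on hdense (map_continuous _)
      (map_continuous _) ?_)
    rintro _ ⟨f, hf, rfl⟩
    exact DFunLike.congr_fun h ⟨opT f, opT_mem_strongSpace hf⟩
  have hxe : x = e := Subtype.ext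
    ((mem_extremePoints_weakBall_iff.1 he).2 _ x.2 _ y.2 ⟨a, b, ha, hb, hab, heq⟩)
  rw [hxe]

end Strong

end VectorFunctionSpace

/-! ### The equivalences assembled -/

theorem theoremT {𝕜 K E : Type*} [RCLike 𝕜]
    [TopologicalSpace K] [CompactSpace K] [T2Space K]
    [NormedAddCommGroup E] [NormedSpace 𝕜 E] [CompleteSpace E]
    (H : Submodule 𝕜 C(K, E)) (t : K) :
    List.TFAE [
      ContinuousLinearMapWOT.ofCLM (evalMap H t) ∈
        (wotClosedHull H).extremePoints 𝕜,
      evalMap (weakSpace H) t ∈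
        extDualBall 𝕜 (weakSpace H),
      ∃ x : DualBall 𝕜 E,
        evalMap (strongSpace H) (t, x) ∈
          extDualBall 𝕜 (strongSpace H),
      ∃ e : DualBall 𝕜 E,
        WeakDual.toStrongDual (e : WeakDual 𝕜 E) ∈ extDualBall 𝕜 E ∧
        evalMap (strongSpace H) (t, e) ∈
          extDualBall 𝕜 (strongSpace H)] ∧
    (Dense {y : E | ∃ f ∈ H, f t = y} →
      (evalMap (weakSpace H) t ∈
          extDualBall 𝕜 (weakSpace H) ↔
        ∀ e : DualBall 𝕜 E,
          WeakDual.toStrongDual (e : WeakDual 𝕜 E) ∈ extDualBall 𝕜 E →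
          evalMap (strongSpace H) (t, e) ∈
            extDualBall 𝕜 (strongSpace H))) := by
  have : Nonempty K := ⟨t⟩
  have strong_of_weak (h : evalMap (weakSpace H) t ∈ extDualBall 𝕜 (weakSpace H)) :
      ∃ e : DualBall 𝕜 E, WeakDual.toStrongDual (e : WeakDual 𝕜 E) ∈ extDualBall 𝕜 E ∧
        evalMap (strongSpace H) (t, e) ∈ extDualBall 𝕜 (strongSpace H) := by
    obtain ⟨e, he, hte⟩ :=
      exists_mem_extremePoints_weakEval_mem_extremePoints (mem_extDualBall_iff.1 h)
    exact ⟨e, mem_extDualBall_iff.2 he, mem_extDualBall_iff.2 hte⟩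
  have weak_of_strong (x : DualBall 𝕜 E)
      (h : evalMap (strongSpace H) (t, x) ∈ extDualBall 𝕜 (strongSpace H)) :
      evalMap (weakSpace H) t ∈ extDualBall 𝕜 (weakSpace H) :=
    mem_extDualBall_iff.2 (weakEval_mem_extremePoints_of_strong (mem_extDualBall_iff.1 h))
  refine ⟨?_, fun hdense => ⟨fun h e he => ?_, fun h => ?_⟩⟩
  · tfae_have 1 ↔ 2 := ofCLM_evalMap_mem_extremePoints_iff t
    tfae_have 2 → 4 := strong_of_weak
    tfae_have 4 → 3 := fun ⟨e, _, h⟩ => ⟨e, h⟩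
    tfae_have 3 → 2 := fun ⟨x, h⟩ => weak_of_strong x h
    tfae_finish
  · exact mem_extDualBall_iff.2 (weakEval_mem_extremePoints_of_dense hdense
      (mem_extDualBall_iff.1 h) (mem_extDualBall_iff.1 he))
  -- The universal statement is not vacuous: the weak* compact ball has an extreme point.
  · obtain ⟨e, he⟩ := exists_mem_extremePoints_of_isCompact (isCompact_weakBall (𝕜 := 𝕜) (X := E))
      ⟨0, zero_mem_weakBall⟩
    exact weak_of_strong ⟨e, he.1⟩ (h ⟨e, he.1⟩ (mem_extDualBall_iff.2 he))
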